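/- For a Tychonoff space $X$ and a compact subset $K\subseteq X$, let $\operatorname{Homeo}_K(X)$ be the group of homeomorphisms of $X$ that are the identity on $X\setminus K$, with the compact-open topology, and put $\operatorname{Homeo}_{cpt}(X)=\bigcup_{K}\operatorname{Homeo}_K(X)$, the union being over all compact subsets $K$ of $X$. The space $X$ has the Compactly Supported Homeomorphism Property (CSHP) if the following two topologies on $\operatorname{Homeo}_{cpt}(X)$ coincide: the finest topology making all inclusions $\operatorname{Homeo}_K(X)\to\operatorname{Homeo}_{cpt}(X)$ continuous; and the topology induced from the homeomorphism group $\operatorname{Homeo}(\beta X)$ of the Stone-Čech compactification, with its compact-open topology, via the map $h\mapsto\beta h$ that extends each $h$ to $\beta X$. **Theorem.** Let $k,l\ge 0$ be integers, let $\lambda_1,\ldots,\lambda_k$ be infinite limit ordinals and $\mu_1,\ldots,\mu_l$ successor ordinals, each with the order topology, and let $X=\lambda_1\times\cdots\times\lambda_k\times\mu_1\times\cdots\times\mu_l$ with the product topology. Then $X$ has CSHP if and only if there is an uncountable regular cardinal $\kappa$ such that $\lambda_1=\cdots=\lambda_k=\kappa$ and $\mu_i\le\kappa$ for every $i=1,\ldots,l$.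 -/

import Mathlib

universe u

/-- An ordinal `o`, viewed as the well-ordered type `o.ToType` of order type `o`,
carries the order topology. -/
noncomputable instance ordinalToTypeTopology (o : Ordinal.{u}) : TopologicalSpace o.ToType :=
  Preorder.topology o.ToType

instance ordinalToTypeOrderTopology (o : Ordinal.{u}) : OrderTopology o.ToType := ⟨rfl⟩

namespace CSHP

open TopologicalSpace

section

variable (X : Type u) [TopologicalSpace X]

/-- The compact-open topology on the homeomorphism group `Homeo(X)`. -/
abbrev homeoTopology : TopologicalSpace (X ≃ₜ X) :=
  TopologicalSpace.induced (fun h => (h : C(X, X))) ContinuousMap.compactOpen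

variable {X}

/-- `Homeo_K(X)`: the homeomorphisms of `X` that are the identity outside `K`. -/
def homeoOn (K : Set X) : Subgroup (X ≃ₜ X) where
  carrier := {h | ∀ x, x ∉ K → h x = x}
  mul_mem' := by
    intro a b ha hb x hx
    change a (b x) = x
    rw [hb x hx, ha x hx]
  one_mem' := fun _ _ => rfl
  inv_mem' := by
    intro a ha x hx
    change a.symm x = x
    rw [Homeomorph.symm_apply_eq, ha x hx]

theorem homeoOn_mono {K L : Set X} (h : K ⊆ L) : homeoOn K ≤ homeoOn L :=
  fun _ hf x hx => hf x (fun hK => hx (h hK))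

variable (X)

/-- `Homeo_cpt(X)`, the union of the groups `Homeo_K(X)` over all compact `K ⊆ X`. -/
def homeoCpt : Subgroup (X ≃ₜ X) where
  carrier := ⋃ K : Compacts X, (homeoOn (K : Set X) : Set (X ≃ₜ X))
  mul_mem' := by
    intro a b ha hb
    obtain ⟨K, hK⟩ := Set.mem_iUnion.1 ha
    obtain ⟨L, hL⟩ := Set.mem_iUnion.1 hb
    refine Set.mem_iUnion.2 ⟨K ⊔ L, (homeoOn _).mul_mem
      (homeoOn_mono ?_ hK) (homeoOn_mono ?_ hL)⟩
    · rw [Compacts.coe_sup]; exact Set.subset_union_left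
    · rw [Compacts.coe_sup]; exact Set.subset_union_right
  one_mem' := Set.mem_iUnion.2 ⟨⊥, (homeoOn _).one_mem⟩
  inv_mem' := by
    intro a ha
    obtain ⟨K, hK⟩ := Set.mem_iUnion.1 ha
    exact Set.mem_iUnion.2 ⟨K, (homeoOn _).inv_mem hK⟩

variable {X}

/-- The inclusion `Homeo_K(X) → Homeo_cpt(X)`, for `K` compact. -/
def inclCpt (K : Compacts X) : homeoOn (K : Set X) → homeoCpt X :=
  fun h => ⟨h.1, Set.mem_iUnion.2 ⟨K, h.2⟩⟩

/-- The compact-open topology on `Homeo_K(X)`. -/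
abbrev homeoOnTopology (K : Set X) : TopologicalSpace (homeoOn K) :=
  TopologicalSpace.induced Subtype.val (homeoTopology X)

variable (X)

/-- The finest topology on `Homeo_cpt(X)` making all inclusions `Homeo_K(X) → Homeo_cpt(X)`
continuous. (In Mathlib's order on topologies, finer means smaller, so this is a supremum.) -/
abbrev colimTopology : TopologicalSpace (homeoCpt X) :=
  ⨆ K : Compacts X, TopologicalSpace.coinduced (inclCpt K) (homeoOnTopology (K : Set X))

variable {X}

/-- The continuous extension `βX → βX` of a homeomorphism of `X`. -/
noncomputable def stoneCechMap (h : X ≃ₜ X) : StoneCech X → StoneCech X :=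
  stoneCechExtend (continuous_stoneCechUnit.comp h.continuous)

theorem continuous_stoneCechMap (h : X ≃ₜ X) : Continuous (stoneCechMap h) :=
  continuous_stoneCechExtend _

theorem stoneCechMap_unit (h : X ≃ₜ X) (x : X) :
    stoneCechMap h (stoneCechUnit x) = stoneCechUnit (h x) :=
  stoneCechExtend_stoneCechUnit _ x

theorem stoneCechMap_symm_comp (h : X ≃ₜ X) : stoneCechMap h.symm ∘ stoneCechMap h = id := by
  refine stoneCech_hom_ext
    ((continuous_stoneCechMap h.symm).comp (continuous_stoneCechMap h)) continuous_id ?_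
  funext x
  simp [stoneCechMap_unit]

/-- The homeomorphism `βh` of `βX` extending a homeomorphism `h` of `X`. -/
noncomputable def stoneCechHomeo (h : X ≃ₜ X) : StoneCech X ≃ₜ StoneCech X where
  toFun := stoneCechMap h
  invFun := stoneCechMap h.symm
  left_inv := fun p => congrFun (stoneCechMap_symm_comp h) p
  right_inv := fun p => congrFun (stoneCechMap_symm_comp h.symm) p
  continuous_toFun := continuous_stoneCechMap h
  continuous_invFun := continuous_stoneCechMap h.symm

variable (X)

/-- The topology on `Homeo_cpt(X)` induced by `Homeo(βX)`, with its compact-open topology,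
through `h ↦ βh`. -/
noncomputable abbrev betaTopology : TopologicalSpace (homeoCpt X) :=
  TopologicalSpace.induced (fun h => stoneCechHomeo h.1) (homeoTopology (StoneCech X))

/-- The Compactly Supported Homeomorphism Property of a Tychonoff space `X`. -/
def HasCSHP [T35Space X] : Prop :=
  colimTopology X = betaTopology X

end

end CSHP

-- The colimit topology always refines the one induced from `βX`, so CSHP asks that every
-- colimit-open set be a neighbourhood of its points in the topology of uniform convergence in `βX`.
--
-- Sufficiency (`hasCSHP_of_homeomorph_pi`). Suppose a colimit-open `O` is not such a neighbourhood
-- of `h₀ ∈ O`. For every finite set `F` of ordinals there is `h F ∉ O` such that `h₀ x` and `h F x`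
-- always lie on the same sides of the cuts in `F`. As `κ` is regular and uncountable,
-- `exists_closure_point` gives `α < κ` such that `F ⊆ α` forces `h F` to be supported in the
-- compact set `K` of points with all coordinates at most `α`. Near `h₀` the compact-open topology
-- of `Homeo_K` is controlled by finitely many cuts; those at or above `α` are respected
-- automatically, so some `h F` with `F ⊆ α` lies in `O`.
--
-- Necessity. A set of homeomorphisms closed in each `Homeo_K`, missing the identity but
-- approximating it uniformly, refutes CSHP. If a limit factor has countable cofinality,
-- transpositions from an escaping sequence of isolated points form such a set. If a factor has
-- uncountable cofinality `κ` and some factor exceeds `κ`, there are escaping isolated points `x γ`,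
-- `γ < κ`, and a disjoint open copy of `[0, κ]`. The transposition of `x γ'` and `x γ` is paired
-- with an involution of `[0, κ]` that tends to the identity as `γ → κ` yet records `γ` at a single
-- isolated point; this makes the family closed (`not_hasCSHP_of_isOpenEmbedding_Iic`). Taking `κ`
-- to be the least cofinality of the limit factors bounds all factors by `κ`.

universe v

namespace CSHP

open TopologicalSpace Topology Filter Uniformity

/-! ### The two topologies, and obstructions to CSHP in general spaces. -/

section General

variable {X : Type u} [TopologicalSpace X]

noncomputable instance stoneCechUniformSpace : UniformSpace (StoneCech X) :=
  uniformSpaceOfCompactR1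

/-- On the compact space `βX` the compact-open topology is uniform convergence, and closeness for a
closed entourage passes from the dense image of `X` to all of `βX`. -/
theorem exists_entourage_of_mem_nhds_betaTopology {h₀ : homeoCpt X} {O : Set (homeoCpt X)}
    (hO : O ∈ @nhds _ (betaTopology X) h₀) :
    ∃ V ∈ 𝓤 (StoneCech X), ∀ h : homeoCpt X,
      (∀ x, (stoneCechUnit (h₀.1 x), stoneCechUnit (h.1 x)) ∈ V) → h ∈ O := by
  rw [betaTopology, homeoTopology, induced_compose, nhds_induced, mem_comap] at hO
  obtain ⟨t, ht, hto⟩ := hO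
  rw [UniformSpace.mem_nhds_iff] at ht
  obtain ⟨W, hW, hWt⟩ := ht
  obtain ⟨V, hV, hVW⟩ := ContinuousMap.hasBasis_compactConvergenceUniformity_of_compact.mem_iff.1 hW
  obtain ⟨V', ⟨hV', hc⟩, hVV'⟩ := uniformity_hasBasis_closed.mem_iff.1 hV
  refine ⟨V', hV', fun h hh => hto (hWt (hVW fun p => hVV' ?_))⟩
  have hcl : IsClosed {p : StoneCech X | (stoneCechMap h₀.1 p, stoneCechMap h.1 p) ∈ V'} :=
    hc.preimage ((continuous_stoneCechMap _).prodMk (continuous_stoneCechMap _))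
  have : ∀ p, p ∈ {p : StoneCech X | (stoneCechMap h₀.1 p, stoneCechMap h.1 p) ∈ V'} := by
    refine fun p => isClosed_property denseRange_stoneCechUnit hcl (fun x => ?_) p
    rw [stoneCechMap_unit, stoneCechMap_unit]
    exact hh x
  exact this p

theorem continuous_coe_homeoOn (K : Set X) :
    @Continuous _ _ (homeoOnTopology K) _ (fun h : homeoOn K => (h.1 : C(X, X))) := by
  rw [homeoOnTopology, homeoTopology, induced_compose]
  exact continuous_induced_dom

/-- Members of `Homeo_K(X)` agree off `K`, so uniform closeness on `K` is already uniform closeness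
on `X`. -/
theorem colimTopology_le_betaTopology : colimTopology X ≤ betaTopology X := by
  refine iSup_le fun K => ?_
  rw [← continuous_iff_coinduced_le]
  let _ := homeoOnTopology (K : Set X)
  let _ := betaTopology X
  rw [continuous_iff_continuousAt]
  intro h₀
  rw [ContinuousAt, tendsto_def]
  intro O hO
  obtain ⟨V, hV, hVO⟩ := exists_entourage_of_mem_nhds_betaTopology hO
  let e : homeoOn (K : Set X) → C(X, StoneCech X) := fun h =>
    (⟨stoneCechUnit, continuous_stoneCechUnit⟩ : C(X, StoneCech X)).comp (h.1 : C(X, X))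
  have he : Continuous e :=
    (ContinuousMap.continuous_postcomp _).comp (continuous_coe_homeoOn (K : Set X))
  have h1 := ContinuousMap.tendsto_iff_forall_isCompact_tendstoUniformlyOn.1
    (he.tendsto h₀) K K.isCompact V hV
  filter_upwards [h1] with h hh
  refine hVO _ fun x => ?_
  by_cases hx : x ∈ (K : Set X)
  · exact hh x hx
  · change (stoneCechUnit (h₀.1 x), stoneCechUnit (h.1 x)) ∈ V
    rw [h₀.2 x hx, h.2 x hx]
    exact refl_mem_uniformity hV

theorem isClosed_colimTopology_iff {C : Set (homeoCpt X)} :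
    @IsClosed _ (colimTopology X) C ↔
      ∀ K : Compacts X, @IsClosed _ (homeoOnTopology (K : Set X)) (inclCpt K ⁻¹' C) := by
  rw [isClosed_iSup_iff]
  exact forall_congr' fun K => isClosed_coinduced

theorem isOpen_colimTopology_iff {C : Set (homeoCpt X)} :
    @IsOpen _ (colimTopology X) C ↔
      ∀ K : Compacts X, @IsOpen _ (homeoOnTopology (K : Set X)) (inclCpt K ⁻¹' C) := by
  rw [isOpen_iSup_iff]
  exact forall_congr' fun K => isOpen_coinduced

theorem continuous_eval_homeoOn (K : Set X) (x : X) :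
    @Continuous _ _ (homeoOnTopology K) _ (fun h : homeoOn K => h.1 x) := by
  let _ := homeoOnTopology K
  exact (continuous_eval_const (F := C(X, X)) x).comp (continuous_coe_homeoOn K)

theorem t1Space_homeoOn [T1Space X] (K : Set X) : @T1Space _ (homeoOnTopology K) := by
  let _ := homeoOnTopology K
  refine ⟨fun h => ?_⟩
  have : ({h} : Set (homeoOn K)) = ⋂ x, (fun g : homeoOn K => g.1 x) ⁻¹' {h.1 x} := by
    ext g
    simp only [Set.mem_singleton_iff, Set.mem_iInter, Set.mem_preimage]
    exact ⟨fun e x => by rw [e], fun e => Subtype.ext (Homeomorph.ext e)⟩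
  rw [this]
  exact isClosed_iInter fun x => isClosed_singleton.preimage (continuous_eval_homeoOn K x)

/-- A family of compactly supported homeomorphisms, closed in each `Homeo_K(X)`, which avoids the
identity but approximates it uniformly, contradicts CSHP. -/
theorem not_hasCSHP_of_approx_one [T35Space X] (C : Set (homeoCpt X))
    (hC : ∀ K : Compacts X, @IsClosed _ (homeoOnTopology (K : Set X)) (inclCpt K ⁻¹' C))
    (h1 : (1 : homeoCpt X) ∉ C)
    (happ : ∀ V ∈ 𝓤 (StoneCech X), ∃ h ∈ C,
      ∀ x, (stoneCechUnit x, stoneCechUnit (h.1 x)) ∈ V) :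
    ¬ HasCSHP X := by
  intro H
  have hcl := isClosed_colimTopology_iff.2 hC
  rw [show colimTopology X = betaTopology X from H] at hcl
  let _ := betaTopology X
  have hn : Cᶜ ∈ 𝓝 (1 : homeoCpt X) := hcl.isOpen_compl.mem_nhds h1
  obtain ⟨V, hV, hVC⟩ := exists_entourage_of_mem_nhds_betaTopology hn
  obtain ⟨h, hh, hhV⟩ := happ V hV
  exact hVC h hhV hh

/-- Total boundedness and the pigeonhole principle. -/
theorem exists_ne_mem_entourage {Y : Type*} [UniformSpace Y] [CompactSpace Y] {ι : Type*}
    [Infinite ι] (f : ι → Y) {V : Set (Y × Y)} (hV : V ∈ 𝓤 Y) :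
    ∃ i j, i ≠ j ∧ (f i, f j) ∈ V ∧ (f j, f i) ∈ V := by
  obtain ⟨W, hW, hsymm, hWV⟩ := comp_symm_mem_uniformity_sets hV
  obtain ⟨t, ht, htc⟩ := (isCompact_univ (X := Y)).totallyBounded W hW
  have : ∀ i, ∃ y : t, (f i, y.1) ∈ W := fun i => by
    obtain ⟨y, hy, hy'⟩ := Set.mem_iUnion₂.1 (htc (Set.mem_univ (f i)))
    exact ⟨⟨y, hy⟩, hy'⟩
  choose y hy using this
  have := ht.to_subtype
  obtain ⟨i, j, hij, hyij⟩ := Finite.exists_ne_map_eq_of_infinite y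
  have hj := hy j
  rw [← hyij] at hj
  refine ⟨i, j, hij, hWV ⟨(y i).1, hy i, ?_⟩, hWV ⟨(y i).1, hj, ?_⟩⟩
  · exact hsymm.symm _ _ hj
  · exact hsymm.symm _ _ (hy i)

/-- The homeomorphism underlying a continuous involution. -/
def homeoOfInvolutive (g : X → X) (hg : Function.Involutive g) (hc : Continuous g) : X ≃ₜ X where
  toEquiv := hg.toPerm
  continuous_toFun := hc
  continuous_invFun := hc

open Classical in
theorem continuous_swap [T1Space X] {a b : X} (ha : IsOpen ({a} : Set X))
    (hb : IsOpen ({b} : Set X)) : Continuous (Equiv.swap a b) := by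
  rw [continuous_iff_continuousAt]
  intro x
  by_cases hxa : x = a
  · subst hxa; rw [ContinuousAt, (isOpen_singleton_iff_nhds_eq_pure _).1 ha]
    exact tendsto_pure_nhds _ _
  by_cases hxb : x = b
  · subst hxb; rw [ContinuousAt, (isOpen_singleton_iff_nhds_eq_pure _).1 hb]
    exact tendsto_pure_nhds _ _
  have : ∀ᶠ y in 𝓝 x, id y = Equiv.swap a b y := by
    filter_upwards [isOpen_ne.mem_nhds hxa, isOpen_ne.mem_nhds hxb] with y h1 h2
    exact (Equiv.swap_apply_of_ne_of_ne h1 h2).symm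
  exact continuousAt_id.congr this

open Classical in
/-- The homeomorphism exchanging two isolated points. -/
noncomputable def swapHomeo [T1Space X] {a b : X} (ha : IsOpen ({a} : Set X))
    (hb : IsOpen ({b} : Set X)) : X ≃ₜ X where
  toEquiv := Equiv.swap a b
  continuous_toFun := continuous_swap ha hb
  continuous_invFun := by rw [Equiv.invFun_as_coe, Equiv.symm_swap]; exact continuous_swap ha hb

section swapHomeo

variable [T1Space X] {a b : X} (ha : IsOpen ({a} : Set X)) (hb : IsOpen ({b} : Set X))

theorem swapHomeo_left : swapHomeo ha hb a = b := by classical exact Equiv.swap_apply_left a b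

theorem swapHomeo_right : swapHomeo ha hb b = a := by classical exact Equiv.swap_apply_right a b

theorem swapHomeo_of_ne {x : X} (h1 : x ≠ a) (h2 : x ≠ b) : swapHomeo ha hb x = x := by
  classical exact Equiv.swap_apply_of_ne_of_ne h1 h2

end swapHomeo

/-- If every compact set contains only finitely many terms of some sequence of distinct isolated
points, CSHP fails. -/
theorem not_hasCSHP_of_escaping_sequence [T35Space X] (x : ℕ → X) (hx : Function.Injective x)
    (hiso : ∀ n, IsOpen ({x n} : Set X)) (hfin : ∀ K : Set X, IsCompact K → {n | x n ∈ K}.Finite) :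
    ¬ HasCSHP X := by
  let s : ℕ × ℕ → (X ≃ₜ X) := fun p => swapHomeo (hiso p.1) (hiso p.2)
  have hs : ∀ p, s p ∈ homeoCpt X := fun p => by
    refine Set.mem_iUnion.2 ⟨⟨{x p.1, x p.2}, (Set.toFinite _).isCompact⟩, fun y hy => ?_⟩
    simp only [Compacts.coe_mk, Set.mem_insert_iff, Set.mem_singleton_iff, not_or] at hy
    exact swapHomeo_of_ne _ _ hy.1 hy.2
  refine not_hasCSHP_of_approx_one ((fun p => (⟨s p, hs p⟩ : homeoCpt X)) '' {p | p.1 ≠ p.2})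
    (fun K => ?_) ?_ fun V hV => ?_
  · let _ := homeoOnTopology (K : Set X)
    have := t1Space_homeoOn (K : Set X)
    -- A transposition belonging to `Homeo_K` moves both of its points, so both lie in `K`, which
    -- leaves finitely many.
    refine Set.Finite.isClosed ?_
    refine Set.Finite.of_finite_image (f := Subtype.val) ?_ Subtype.val_injective.injOn
    refine (((hfin K K.isCompact).prod (hfin K K.isCompact)).image s).subset ?_
    rintro _ ⟨h, ⟨p, hp, hpe⟩, rfl⟩
    have hsh : s p = h.1 := congrArg Subtype.val hpe
    refine ⟨p, ⟨by_contra fun hn => hp ?_, by_contra fun hn => hp ?_⟩, hsh⟩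
    · have := h.2 _ hn
      rw [← hsh, show s p (x p.1) = x p.2 from swapHomeo_left _ _] at this
      exact (hx this).symm
    · have := h.2 _ hn
      rw [← hsh, show s p (x p.2) = x p.1 from swapHomeo_right _ _] at this
      exact hx this
  · rintro ⟨p, hp, hp1⟩
    have : s p (x p.1) = x p.1 := by
      rw [show s p = 1 from congrArg Subtype.val hp1]; rfl
    rw [show s p (x p.1) = x p.2 from swapHomeo_left _ _] at this
    exact hp (hx this).symm
  · obtain ⟨i, j, hij, h1, h2⟩ := exists_ne_mem_entourage (fun n => stoneCechUnit (x n)) hV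
    refine ⟨_, ⟨(i, j), hij, rfl⟩, fun y => ?_⟩
    change (stoneCechUnit y, stoneCechUnit (swapHomeo (hiso i) (hiso j) y)) ∈ V
    by_cases hyi : y = x i
    · rw [hyi, swapHomeo_left]; exact h1
    by_cases hyj : y = x j
    · rw [hyj, swapHomeo_right]; exact h2
    rw [swapHomeo_of_ne _ _ hyi hyj]
    exact refl_mem_uniformity hV

end General

end CSHP

namespace CSHP

open TopologicalSpace Topology Filter Uniformity

/-! ### Involutions exchanging the endpoints of disjoint intervals. -/

section PairSwap

variable {L : Type*} {J : Type*}

open Classical in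
/-- The map exchanging `a j` and `b j` for every `j` and fixing all other points. -/
noncomputable def pairSwap (a b : J → L) (y : L) : L :=
  if h : ∃ j, a j = y then b h.choose else if h : ∃ j, b j = y then a h.choose else y

theorem pairSwap_of_ne {a b : J → L} {y : L} (ha : ∀ j, a j ≠ y) (hb : ∀ j, b j ≠ y) : pairSwap a b y = y := by
  rw [pairSwap, dif_neg (by simpa using ha), dif_neg (by simpa using hb)]

variable [LinearOrder L]

/-- The closed intervals `[a j, b j]` are nondegenerate and pairwise disjoint. -/
structure DisjointIntervals (a b : J → L) : Prop where
  lt : ∀ j, a j < b j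
  eq_of_mem : ∀ {i j z}, z ∈ Set.Icc (a i) (b i) → z ∈ Set.Icc (a j) (b j) → i = j

namespace DisjointIntervals

variable {a b : J → L}

theorem pairSwap_left (H : DisjointIntervals a b) (j : J) : pairSwap a b (a j) = b j := by
  have h : ∃ i, a i = a j := ⟨j, rfl⟩
  rw [pairSwap, dif_pos h]
  have := h.choose_spec
  rw [H.eq_of_mem (z := a j) ⟨this.le, this.ge.trans (H.lt _).le⟩ ⟨le_rfl, (H.lt j).le⟩]

theorem pairSwap_right (H : DisjointIntervals a b) (j : J) : pairSwap a b (b j) = a j := by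
  have h : ∃ i, b i = b j := ⟨j, rfl⟩
  have h' : ¬ ∃ i, a i = b j := by
    rintro ⟨i, hi⟩
    have hij : i = j := H.eq_of_mem (z := b j) ⟨hi.le, hi ▸ (H.lt i).le⟩ ⟨(H.lt j).le, le_rfl⟩
    subst hij
    exact (H.lt i).ne hi
  rw [pairSwap, dif_neg h', dif_pos h]
  have := h.choose_spec
  rw [H.eq_of_mem (z := b j) ⟨(H.lt _).le.trans this.le, this.ge⟩ ⟨(H.lt j).le, le_rfl⟩]

theorem involutive_pairSwap (H : DisjointIntervals a b) : Function.Involutive (pairSwap a b) := by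
  intro y
  by_cases ha : ∃ j, a j = y
  · obtain ⟨j, rfl⟩ := ha
    rw [H.pairSwap_left, H.pairSwap_right]
  by_cases hb : ∃ j, b j = y
  · obtain ⟨j, rfl⟩ := hb
    rw [H.pairSwap_right, H.pairSwap_left]
  push Not at ha hb
  rw [pairSwap_of_ne ha hb, pairSwap_of_ne ha hb]

theorem eq_of_lt_pairSwap (H : DisjointIntervals a b) {y : L} (hy : y < pairSwap a b y) :
    ∃ j, y = a j ∧ pairSwap a b y = b j := by
  by_cases ha : ∃ j, a j = y
  · obtain ⟨j, rfl⟩ := ha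
    exact ⟨j, rfl, H.pairSwap_left j⟩
  by_cases hb : ∃ j, b j = y
  · obtain ⟨j, rfl⟩ := hb
    rw [H.pairSwap_right] at hy
    exact absurd hy (H.lt j).not_gt
  push Not at ha hb
  rw [pairSwap_of_ne ha hb] at hy
  exact absurd hy (lt_irrefl _)

theorem eq_of_pairSwap_lt (H : DisjointIntervals a b) {y : L} (hy : pairSwap a b y < y) :
    ∃ j, y = b j ∧ pairSwap a b y = a j := by
  obtain ⟨j, h1, h2⟩ := H.eq_of_lt_pairSwap (y := pairSwap a b y)
    (by rwa [H.involutive_pairSwap y])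
  exact ⟨j, by rw [← h2, H.involutive_pairSwap y], h1⟩

/-- Crossing any given point happens at most once, so only finitely many points near a fixed point
are moved far away. -/
theorem continuous_pairSwap (H : DisjointIntervals a b) [TopologicalSpace L] [OrderTopology L]
    (ha : ∀ j, IsOpen ({a j} : Set L)) (hb : ∀ j, IsOpen ({b j} : Set L)) :
    Continuous (pairSwap a b) := by
  rw [continuous_iff_continuousAt]
  intro e
  by_cases hea : ∃ j, a j = e
  · obtain ⟨j, rfl⟩ := hea
    rw [ContinuousAt, (isOpen_singleton_iff_nhds_eq_pure _).1 (ha j)]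
    exact tendsto_pure_nhds _ _
  by_cases heb : ∃ j, b j = e
  · obtain ⟨j, rfl⟩ := heb
    rw [ContinuousAt, (isOpen_singleton_iff_nhds_eq_pure _).1 (hb j)]
    exact tendsto_pure_nhds _ _
  push Not at hea heb
  have he : pairSwap a b e = e := pairSwap_of_ne hea heb
  rw [ContinuousAt, he]
  refine tendsto_order.2 ⟨fun d hd => ?_, fun d hd => ?_⟩
  · have hs : {y | pairSwap a b y ≤ d ∧ d < y}.Subsingleton := by
      rintro y ⟨hy, hy'⟩ z ⟨hz, hz'⟩
      obtain ⟨i, hi, hi'⟩ := H.eq_of_pairSwap_lt (hy.trans_lt hy')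
      obtain ⟨j, hj, hj'⟩ := H.eq_of_pairSwap_lt (hz.trans_lt hz')
      rw [hi, hj, H.eq_of_mem (z := d) (i := i) (j := j) ⟨hi' ▸ hy, hi ▸ hy'.le⟩
        ⟨hj' ▸ hz, hj ▸ hz'.le⟩]
    have hn : e ∉ {y | pairSwap a b y ≤ d ∧ d < y} := fun h => (h.1.trans_lt hd).ne he
    filter_upwards [hs.finite.isClosed.isOpen_compl.mem_nhds hn, lt_mem_nhds hd] with y hy hdy
    exact not_le.1 fun h => hy ⟨h, hdy⟩
  · have hs : {y | d ≤ pairSwap a b y ∧ y < d}.Subsingleton := by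
      rintro y ⟨hy, hy'⟩ z ⟨hz, hz'⟩
      obtain ⟨i, hi, hi'⟩ := H.eq_of_lt_pairSwap (hy'.trans_le hy)
      obtain ⟨j, hj, hj'⟩ := H.eq_of_lt_pairSwap (hz'.trans_le hz)
      rw [hi, hj, H.eq_of_mem (z := d) (i := i) (j := j) ⟨hi ▸ hy'.le, hi' ▸ hy⟩
        ⟨hj ▸ hz'.le, hj' ▸ hz⟩]
    have hn : e ∉ {y | d ≤ pairSwap a b y ∧ y < d} := fun h => (hd.trans_le h.1).ne' he
    filter_upwards [hs.finite.isClosed.isOpen_compl.mem_nhds hn, gt_mem_nhds hd] with y hy hdy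
    exact not_le.1 fun h => hy ⟨h, hdy⟩

end DisjointIntervals

end PairSwap

section ExtendFun

variable {A X : Type*} {φ : A → X}

/-- The self-map of `X` which is `g` on the image of `φ` and the identity elsewhere. -/
noncomputable def extendFun (φ : A → X) (g : A → A) : X → X := Function.extend φ (φ ∘ g) id

theorem extendFun_apply (hφ : Function.Injective φ) (g : A → A) (t : A) :
    extendFun φ g (φ t) = φ (g t) :=
  hφ.extend_apply _ _ t

theorem extendFun_of_notMem (g : A → A) {y : X} (hy : y ∉ Set.range φ) : extendFun φ g y = y :=
  Function.extend_apply' _ _ _ hy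

theorem involutive_extendFun (hφ : Function.Injective φ) {g : A → A}
    (hg : Function.Involutive g) : Function.Involutive (extendFun φ g) := by
  intro y
  by_cases hy : y ∈ Set.range φ
  · obtain ⟨t, rfl⟩ := hy
    rw [extendFun_apply hφ, extendFun_apply hφ, hg t]
  · rw [extendFun_of_notMem g hy, extendFun_of_notMem g hy]

/-- The image of `φ` is clopen, being compact and open, so the two pieces glue. -/
theorem continuous_extendFun [TopologicalSpace A] [TopologicalSpace X] [CompactSpace A] [T2Space X] (hφ : IsOpenEmbedding φ) {g : A → A}
    (hg : Continuous g) : Continuous (extendFun φ g) := by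
  rw [continuous_iff_continuousAt]
  intro y
  by_cases hy : y ∈ Set.range φ
  · obtain ⟨t, rfl⟩ := hy
    rw [← hφ.continuousAt_iff]
    have : extendFun φ g ∘ φ = φ ∘ g := funext (extendFun_apply hφ.injective g)
    rw [this]
    exact (hφ.continuous.comp hg).continuousAt
  · have hcl : IsClosed (Set.range φ) := (isCompact_range hφ.continuous).isClosed
    refine continuousAt_id.congr ?_
    filter_upwards [hcl.isOpen_compl.mem_nhds hy] with z hz
    exact (extendFun_of_notMem g hz).symm

end ExtendFun

/-! ### The coding involutions of `[0, κ]`. -/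

section Ordinal

open Ordinal Cardinal

/-- Powers of `ω` are additively closed; hence the block attached to `β` ends before the next power
of `ω`, and distinct blocks are disjoint. -/
theorem omega0_opow_add_lt {β γ : Ordinal.{v}} (h : γ < β) : ω ^ β + (γ + 2) < ω ^ (β + 1) := by
  have hβ : ω ^ β < ω ^ (β + 1) := (opow_lt_opow_iff_right one_lt_omega0).2 (lt_add_one β)
  have hp := isPrincipal_add_omega0_opow (β + 1)
  refine hp hβ (hp ?_ ?_)
  · exact h.trans_le ((right_le_opow β one_lt_omega0).trans hβ.le)
  · have : ω ^ (1 : Ordinal) ≤ ω ^ (β + 1) :=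
      (opow_le_opow_iff_right one_lt_omega0).2 (by simp)
    rw [opow_one] at this
    exact (natCast_lt_omega0 2).trans_le this

theorem disjointIntervals_omega0_opow (γ : Ordinal.{v}) (S : Set Ordinal.{v}) :
    DisjointIntervals (J := {β // γ < β ∧ β ∈ S}) (fun β => ω ^ β.1 + 1)
      (fun β => ω ^ β.1 + (γ + 2)) where
  lt j := by
    refine (add_lt_add_iff_left _).2 ?_
    exact (by norm_num : (1 : Ordinal) < 2).trans_le le_add_self
  eq_of_mem := by
    have key : ∀ i j : {β // γ < β ∧ β ∈ S}, ∀ z, z ∈ Set.Icc (ω ^ i.1 + 1) (ω ^ i.1 + (γ + 2)) →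
        z ∈ Set.Icc (ω ^ j.1 + 1) (ω ^ j.1 + (γ + 2)) → ¬ i.1 < j.1 := by
      intro i j z hi hj hij
      have h1 := hi.2.trans_lt (omega0_opow_add_lt i.2.1)
      have h2 : ω ^ (i.1 + 1) ≤ ω ^ j.1 :=
        (opow_le_opow_iff_right one_lt_omega0).2 (Order.add_one_le_of_lt hij)
      exact absurd (hj.1.trans_lt (h1.trans_le h2)) (not_lt.2 le_self_add)
    intro i j z hi hj
    rcases lt_trichotomy i.1 j.1 with h | h | h
    · exact absurd h (key i j z hi hj)
    · exact Subtype.ext h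
    · exact absurd h (key j i z hj hi)

theorem isOpen_singleton_add_one (o : Ordinal.{v}) : IsOpen ({o + 1} : Set Ordinal.{v}) := by
  rw [SuccOrder.isOpen_singleton_iff]
  exact Order.not_isSuccLimit_succ o

theorem isOpen_singleton_subtype {S : Set Ordinal.{v}} {t : S} (h : IsOpen ({t.1} : Set Ordinal)) :
    IsOpen ({t} : Set S) := by
  have : ({t} : Set S) = Subtype.val ⁻¹' {t.1} := by
    ext s
    simp [Subtype.ext_iff]
  rw [this]
  exact h.preimage continuous_subtype_val

theorem omega0_opow_add_lt_ord {κ : Cardinal.{v}} (hκ : ℵ₀ < κ) {β γ : Ordinal.{v}} (h : γ < β)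
    (hβ : β < κ.ord) : ω ^ β + (γ + 2) < κ.ord := by
  refine (omega0_opow_add_lt h).trans (isPrincipal_opow_ord hκ.le ?_ ?_)
  · rwa [lt_ord, card_omega0]
  · exact (isSuccLimit_ord hκ.le).add_one_lt hβ

/-- The involution of `[0, κ]` exchanging `ω ^ β + 1` and `ω ^ β + (γ + 2)` for `γ < β < κ`. -/
noncomputable def blockSwap (κ : Cardinal.{v}) (γ : Ordinal.{v}) : Ordinal.{v} → Ordinal.{v} :=
  pairSwap (J := {β // γ < β ∧ β ∈ Set.Iio κ.ord}) (fun β => ω ^ β.1 + 1)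
    (fun β => ω ^ β.1 + (γ + 2))

variable {κ : Cardinal.{v}} {γ : Ordinal.{v}}

/-- The value at the one point `ω ^ β + 1` determines `γ`, for all `γ < β` at once. -/
theorem blockSwap_left {β : Ordinal.{v}} (h : γ < β) (hβ : β < κ.ord) :
    blockSwap κ γ (ω ^ β + 1) = ω ^ β + (γ + 2) :=
  (disjointIntervals_omega0_opow γ _).pairSwap_left ⟨β, h, hβ⟩

theorem continuous_blockSwap : Continuous (blockSwap κ γ) := by
  refine (disjointIntervals_omega0_opow γ _).continuous_pairSwap
    (fun j => isOpen_singleton_add_one _) fun j => ?_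
  have : ω ^ j.1 + (γ + 2) = ω ^ j.1 + (γ + 1) + 1 := by
    rw [add_assoc, add_assoc, one_add_one_eq_two]
  rw [this]
  exact isOpen_singleton_add_one _

theorem involutive_blockSwap : Function.Involutive (blockSwap κ γ) :=
  (disjointIntervals_omega0_opow γ _).involutive_pairSwap

/-- Only points strictly between `γ` and `κ` move, and they stay there; hence the involutions
approach the identity as `γ → κ`. -/
theorem blockSwap_eq_or (hκ : ℵ₀ < κ) (y : Ordinal.{v}) : blockSwap κ γ y = y ∨
    (y ∈ Set.Ioo γ κ.ord ∧ blockSwap κ γ y ∈ Set.Ioo γ κ.ord) := by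
  have H := disjointIntervals_omega0_opow γ (Set.Iio κ.ord)
  have ha : ∀ j : {β // γ < β ∧ β ∈ Set.Iio κ.ord}, ω ^ j.1 + 1 ∈ Set.Ioo γ κ.ord := fun j =>
    ⟨(j.2.1.trans_le (right_le_opow _ one_lt_omega0)).trans_le le_self_add,
      (H.lt j).trans (omega0_opow_add_lt_ord hκ j.2.1 j.2.2)⟩
  have hb : ∀ j : {β // γ < β ∧ β ∈ Set.Iio κ.ord}, ω ^ j.1 + (γ + 2) ∈ Set.Ioo γ κ.ord := fun j =>
    ⟨(ha j).1.trans (H.lt j), omega0_opow_add_lt_ord hκ j.2.1 j.2.2⟩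
  rcases lt_trichotomy (blockSwap κ γ y) y with h | h | h
  · obtain ⟨j, h1, h2⟩ := H.eq_of_pairSwap_lt h
    exact .inr ⟨h1 ▸ hb j, (show blockSwap κ γ y = _ from h2) ▸ ha j⟩
  · exact .inl h
  · obtain ⟨j, h1, h2⟩ := H.eq_of_lt_pairSwap h
    exact .inr ⟨h1 ▸ ha j, (show blockSwap κ γ y = _ from h2) ▸ hb j⟩

/-- The involution `blockSwap` on the compact space `[0, κ]`. -/
noncomputable def blockSwapIic (hκ : ℵ₀ < κ) (γ : Ordinal.{v}) (t : Set.Iic κ.ord) :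
    Set.Iic κ.ord :=
  ⟨blockSwap κ γ t.1, by
    rcases blockSwap_eq_or (γ := γ) hκ t.1 with h | h
    · rw [h]; exact t.2
    · exact h.2.2.le⟩

theorem involutive_blockSwapIic (hκ : ℵ₀ < κ) : Function.Involutive (blockSwapIic hκ γ) :=
  fun t => Subtype.ext (involutive_blockSwap t.1)

theorem continuous_blockSwapIic (hκ : ℵ₀ < κ) : Continuous (blockSwapIic hκ γ) :=
  (continuous_blockSwap.comp continuous_subtype_val).subtype_mk _

instance compactSpace_Iic_ordinal (o : Ordinal.{v}) : CompactSpace (Set.Iic o) := by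
  rw [← Set.Icc_bot]
  infer_instance

end Ordinal

theorem isClosed_of_locally_subsingleton {Y : Type*} [TopologicalSpace Y] [T1Space Y] {S : Set Y}
    (h : ∀ y, ∃ N ∈ 𝓝 y, (N ∩ S).Subsingleton) : IsClosed S := by
  refine isClosed_of_closure_subset fun y hy => ?_
  obtain ⟨N, hN, hs⟩ := h y
  have : y ∈ closure (N ∩ S) := by
    rw [mem_closure_iff_nhds] at hy ⊢
    intro t ht
    have := hy _ (inter_mem ht hN)
    rwa [Set.inter_assoc] at this
  rw [hs.finite.isClosed.closure_eq] at this
  exact this.2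

open Ordinal Cardinal in
/-- CSHP fails for a space containing, besides an open copy of `[0, κ]`, isolated points indexed
by `κ` which eventually leave every compact set. -/
theorem not_hasCSHP_of_isOpenEmbedding_Iic {X : Type u} [TopologicalSpace X] [T35Space X]
    {κ : Cardinal.{v}} (hκ : ℵ₀ < κ) (φ : Set.Iic κ.ord → X) (hφ : IsOpenEmbedding φ)
    (x : Set.Iio κ.ord → X) (hx : Function.Injective x) (hiso : ∀ γ, IsOpen ({x γ} : Set X))
    (hoff : ∀ γ, x γ ∉ Set.range φ)
    (hbdd : ∀ K : Set X, IsCompact K → ∃ δ < κ.ord, ∀ γ, x γ ∈ K → γ.1 < δ) :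
    ¬ HasCSHP X := by
  let g : Ordinal → X ≃ₜ X := fun γ => homeoOfInvolutive (extendFun φ (blockSwapIic hκ γ))
    (involutive_extendFun hφ.injective (involutive_blockSwapIic hκ))
    (continuous_extendFun hφ (continuous_blockSwapIic hκ))
  -- The involution depends on the second index only, so that index can be decoded first.
  let s : Set.Iio κ.ord × Set.Iio κ.ord → (X ≃ₜ X) := fun p =>
    g p.2 * swapHomeo (hiso p.1) (hiso p.2)
  have hgφ : ∀ γ t, g γ (φ t) = φ (blockSwapIic hκ γ t) := fun γ t =>
    extendFun_apply hφ.injective _ t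
  have hgoff : ∀ γ y, y ∉ Set.range φ → g γ y = y := fun γ y hy => extendFun_of_notMem _ hy
  have hsφ : ∀ p t, s p (φ t) = φ (blockSwapIic hκ p.2 t) := fun p t => by
    change g p.2 (swapHomeo _ _ (φ t)) = _
    rw [swapHomeo_of_ne, hgφ]
    · exact fun h => hoff p.1 ⟨t, h⟩
    · exact fun h => hoff p.2 ⟨t, h⟩
  have hs1 : ∀ p, s p (x p.1) = x p.2 := fun p => by
    change g p.2 (swapHomeo _ _ (x p.1)) = _
    rw [swapHomeo_left, hgoff _ _ (hoff _)]
  have hs2 : ∀ p, s p (x p.2) = x p.1 := fun p => by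
    change g p.2 (swapHomeo _ _ (x p.2)) = _
    rw [swapHomeo_right, hgoff _ _ (hoff _)]
  have hs3 : ∀ p y, y ∉ Set.range φ → y ≠ x p.1 → y ≠ x p.2 → s p y = y := fun p y hy h1 h2 => by
    change g p.2 (swapHomeo _ _ y) = _
    rw [swapHomeo_of_ne _ _ h1 h2, hgoff _ _ hy]
  have hs : ∀ p, s p ∈ homeoCpt X := fun p => by
    refine Set.mem_iUnion.2 ⟨⟨Set.range φ ∪ {x p.1, x p.2},
      (isCompact_range hφ.continuous).union (Set.toFinite _).isCompact⟩, fun y hy => ?_⟩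
    simp only [Compacts.coe_mk, Set.mem_union, Set.mem_insert_iff, Set.mem_singleton_iff,
      not_or] at hy
    exact hs3 p y hy.1 hy.2.1 hy.2.2
  have hlim := isSuccLimit_ord hκ.le
  refine not_hasCSHP_of_approx_one ((fun p => (⟨s p, hs p⟩ : homeoCpt X)) '' {p | p.1 ≠ p.2})
    (fun K => ?_) ?_ fun V hV => ?_
  · let _ := homeoOnTopology (K : Set X)
    have := t1Space_homeoOn (K : Set X)
    obtain ⟨δ, hδ, hδK⟩ := hbdd K K.isCompact
    have haδ : ω ^ δ + 1 ≤ κ.ord :=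
      (hlim.add_one_lt (isPrincipal_opow_ord hκ.le (by rwa [lt_ord, card_omega0]) hδ)).le
    -- Both points exchanged by a member of `Homeo_K` have index below `δ`, so evaluation at this
    -- isolated point decodes the second index.
    let a : Set.Iic κ.ord := ⟨ω ^ δ + 1, haδ⟩
    have haiso : IsOpen ({φ a} : Set X) := by
      rw [← Set.image_singleton]
      exact hφ.isOpenMap _ (isOpen_singleton_subtype (isOpen_singleton_add_one _))
    have hopen : ∀ (h : homeoOn (K : Set X)) (y : X), IsOpen ({y} : Set X) →
        {h' : homeoOn (K : Set X) | h'.1 y = h.1 y} ∈ 𝓝 h := fun h y hy => by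
      refine (continuous_eval_homeoOn (K : Set X) y).continuousAt.preimage_mem_nhds
        (t := {h.1 y}) (IsOpen.mem_nhds ?_ rfl)
      rw [← Set.image_singleton]
      exact h.1.isOpenMap _ hy
    have hrep : ∀ h : homeoOn (K : Set X),
        inclCpt K h ∈ (fun p => (⟨s p, hs p⟩ : homeoCpt X)) '' {p | p.1 ≠ p.2} →
        ∃ p, h.1 = s p ∧ p.2.1 < δ := by
      rintro h ⟨p, hp, hpe⟩
      have hsh : s p = h.1 := congrArg Subtype.val hpe
      refine ⟨p, hsh.symm, hδK _ (by_contra fun hn => hp (hx ?_))⟩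
      rw [← hs2 p, hsh]
      exact h.2 _ hn
    have hinj : ∀ p q : Set.Iio κ.ord × Set.Iio κ.ord, p.2.1 < δ → q.2.1 < δ →
        s p (φ a) = s q (φ a) → p.2 = q.2 := by
      intro p q hp hq h
      rw [hsφ, hsφ] at h
      have h' : blockSwap κ p.2 (ω ^ δ + 1) = blockSwap κ q.2 (ω ^ δ + 1) :=
        congrArg Subtype.val (hφ.injective h)
      rw [blockSwap_left hp hδ, blockSwap_left hq hδ, add_right_inj, ← one_add_one_eq_two,
        ← add_assoc, ← add_assoc] at h'
      exact Subtype.ext (Order.succ_injective (Order.succ_injective h'))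
    refine isClosed_of_locally_subsingleton fun h => ?_
    -- The value at `φ a` fixes the second index, and then the value at `x p.2` fixes the first.
    -- Both points are isolated, so prescribing these values is an open condition.
    by_cases hne : ∃ p, p.2.1 < δ ∧ s p (φ a) = h.1 (φ a)
    · obtain ⟨p, hpδ, hp⟩ := hne
      refine ⟨_, inter_mem (hopen h (φ a) haiso) (hopen h (x p.2) (hiso _)), ?_⟩
      have hmem : ∀ k : homeoOn (K : Set X), k.1 (φ a) = h.1 (φ a) →
          k.1 (x p.2) = h.1 (x p.2) →
          inclCpt K k ∈ (fun p => (⟨s p, hs p⟩ : homeoCpt X)) '' {p | p.1 ≠ p.2} →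
          ∃ γ, k.1 = s (γ, p.2) ∧ h.1 (x p.2) = x γ := by
        intro k h1 h2 h3
        obtain ⟨q, hq, hqδ⟩ := hrep k h3
        have hqp : q.2 = p.2 := hinj q p hqδ hpδ (by rw [← hq, h1, hp])
        refine ⟨q.1, by rw [hq, ← hqp], ?_⟩
        rw [← h2, hq, ← hqp, hs2]
      rintro k₁ ⟨⟨h1, h2⟩, h3⟩ k₂ ⟨⟨h4, h5⟩, h6⟩
      obtain ⟨γ₁, e1, f1⟩ := hmem k₁ h1 h2 h3
      obtain ⟨γ₂, e2, f2⟩ := hmem k₂ h4 h5 h6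
      have : γ₁ = γ₂ := hx (f1.symm.trans f2)
      exact Subtype.ext (by rw [e1, e2, this])
    · refine ⟨_, hopen h (φ a) haiso, ?_⟩
      rintro k ⟨h1, h2⟩
      obtain ⟨q, hq, hqδ⟩ := hrep k h2
      exact absurd ⟨q, hqδ, by rw [← hq]; exact h1⟩ hne
  · rintro ⟨p, hp, hp1⟩
    have : s p (x p.1) = x p.1 := by
      rw [show s p = 1 from congrArg Subtype.val hp1]; rfl
    rw [hs1] at this
    exact hp (hx this).symm
  · let m : Set.Iic κ.ord := ⟨κ.ord, Set.mem_Iic.2 le_rfl⟩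
    -- By continuity at the endpoint `κ`, any two points of some `(δ, κ]` are `V`-close; involutions
    -- with `γ > δ` move points only inside it.
    have hV' : Prod.map (stoneCechUnit ∘ φ) (stoneCechUnit ∘ φ) ⁻¹' V ∈ 𝓝 (m, m) := by
      have hc : Continuous (stoneCechUnit ∘ φ) := continuous_stoneCechUnit.comp hφ.continuous
      refine (hc.prodMap hc).continuousAt.preimage_mem_nhds ?_
      exact nhds_le_uniformity _ hV
    rw [nhds_prod_eq, mem_prod_same_iff] at hV'
    obtain ⟨W, hW, hWV⟩ := hV'
    have hm : (⟨0, Set.mem_Iic.2 zero_le⟩ : Set.Iic κ.ord) < m :=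
      Subtype.mk_lt_mk.2 (hlim.bot_lt)
    obtain ⟨δ, hδ, hδW⟩ := exists_Ioc_subset_of_mem_nhds hW ⟨_, hm⟩
    have hδκ : δ.1 < κ.ord := hδ
    have : NoMaxOrder (Set.Iio κ.ord) :=
      ⟨fun t => ⟨⟨t.1 + 1, hlim.add_one_lt t.2⟩, lt_add_one t.1⟩⟩
    have : Infinite (Set.Ioi (⟨δ.1, hδκ⟩ : Set.Iio κ.ord)) := (Set.Ioi_infinite _).to_subtype
    obtain ⟨i, j, hij, h1, h2⟩ := exists_ne_mem_entourage
      (fun γ : Set.Ioi (⟨δ.1, hδκ⟩ : Set.Iio κ.ord) => stoneCechUnit (x γ.1)) hV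
    refine ⟨_, ⟨(i.1, j.1), fun h => hij (Subtype.ext h), rfl⟩, fun y => ?_⟩
    change (stoneCechUnit y, stoneCechUnit (s (i.1, j.1) y)) ∈ V
    by_cases hy : y ∈ Set.range φ
    · obtain ⟨t, rfl⟩ := hy
      rw [hsφ]
      rcases blockSwap_eq_or (γ := j.1.1) hκ t.1 with h | ⟨h, h'⟩
      · rw [show blockSwapIic hκ j.1.1 t = t from Subtype.ext h]
        exact refl_mem_uniformity hV
      · have hj : δ.1 < j.1.1 := j.2
        exact @hWV (t, blockSwapIic hκ j.1.1 t)
          ⟨hδW ⟨hj.trans h.1, t.2⟩, hδW ⟨hj.trans h'.1, (blockSwapIic hκ j.1.1 t).2⟩⟩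
    by_cases hyi : y = x i.1
    · rw [hyi, hs1 (i.1, j.1)]; exact h1
    by_cases hyj : y = x j.1
    · rw [hyj, hs2 (i.1, j.1)]; exact h2
    rw [hs3 _ _ hy hyi hyj]
    exact refl_mem_uniformity hV

end CSHP

/-! ### Sufficiency: cuts and the closing-off argument. -/

namespace CSHP

open TopologicalSpace Topology Filter Uniformity

/-- The indicator function of a clopen set extends to `βX`, so its level sets there are compact and
open. -/
theorem setOf_mem_iff_mem_nhds_betaTopology {X : Type u} [TopologicalSpace X] {A : Set X}
    (hA : IsClopen A) (h₀ : homeoCpt X) :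
    {h : homeoCpt X | ∀ x, h₀.1 x ∈ A ↔ h.1 x ∈ A} ∈ @nhds _ (betaTopology X) h₀ := by
  classical
  let χ : X → Bool := fun x => decide (x ∈ A)
  have hχ : Continuous χ := (continuous_discrete_rng (f := χ)).2 fun b => by
    cases b
    · have : χ ⁻¹' {false} = Aᶜ := by ext x; simp [χ]
      rw [this]; exact hA.compl.isOpen
    · have : χ ⁻¹' {true} = A := by ext x; simp [χ]
      rw [this]; exact hA.isOpen
  let χ' : StoneCech X → Bool := stoneCechExtend hχ
  have hχ' : Continuous χ' := continuous_stoneCechExtend hχ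
  have hunit : ∀ x, χ' (stoneCechUnit x) = χ x := stoneCechExtend_stoneCechUnit hχ
  let e : homeoCpt X → C(StoneCech X, StoneCech X) := fun h => (stoneCechHomeo h.1 : C(_, _))
  have hmem : ⋂ b : Bool, {f : C(StoneCech X, StoneCech X) |
      Set.MapsTo f (χ' ∘ stoneCechMap h₀.1 ⁻¹' {b}) (χ' ⁻¹' {b})} ∈ 𝓝 (e h₀) := by
    refine Filter.iInter_mem.2 fun b => IsOpen.mem_nhds ?_ fun p hp => hp
    refine ContinuousMap.isOpen_setOfPred_mapsTo ?_ ((isOpen_discrete _).preimage hχ')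
    exact ((isClosed_discrete _).preimage (hχ'.comp (continuous_stoneCechMap _))).isCompact
  rw [betaTopology, homeoTopology, induced_compose, nhds_induced]
  refine mem_of_superset (preimage_mem_comap hmem) fun h hh x => ?_
  have h1 := Set.mem_iInter.1 hh (χ (h₀.1 x)) (x := stoneCechUnit x) (by
    simp [stoneCechMap_unit, hunit])
  have h2 : χ' (stoneCechMap h.1 (stoneCechUnit x)) = χ (h₀.1 x) := h1
  rw [stoneCechMap_unit, hunit] at h2
  simpa [χ, eq_comm] using h2

/-- Two points of a product of ordinals lie on the same side of each cut from `F`. -/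
def SameCuts {ι : Type*} (F : Finset Ordinal.{v}) (y z : ι → Ordinal.{v}) : Prop :=
  ∀ c ∈ F, ∀ i, y i ≤ c ↔ z i ≤ c

theorem exists_finset_cuts_of_mem_nhds {o : Ordinal.{v}} (t : Set.Iio o) {T : Set (Set.Iio o)}
    (hT : T ∈ 𝓝 t) :
    ∃ F : Finset Ordinal.{v}, ∀ s : Set.Iio o, (∀ c ∈ F, t.1 ≤ c ↔ s.1 ≤ c) → s ∈ T := by
  rw [nhds_subtype, mem_comap] at hT
  obtain ⟨W, hW, hWT⟩ := hT
  by_cases h0 : t.1 = 0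
  · refine ⟨{0}, fun s hs => hWT ?_⟩
    have : s.1 ≤ 0 := (hs 0 (by simp)).1 h0.le
    rw [Set.mem_preimage, le_antisymm this zero_le, ← h0]
    exact mem_of_mem_nhds hW
  · obtain ⟨a, ha, haW⟩ := exists_Ioc_subset_of_mem_nhds hW ⟨0, pos_of_ne_zero h0⟩
    refine ⟨{a, t.1}, fun s hs => hWT (haW ⟨?_, ?_⟩)⟩
    · exact not_le.1 fun h => ha.not_ge ((hs a (by simp)).2 h)
    · exact (hs t.1 (by simp)).1 le_rfl

theorem isClopen_Iic_ordinal (c : Ordinal.{v}) : IsClopen (Set.Iic c) :=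
  ⟨isClosed_Iic, by rw [← Order.Iio_succ]; exact isOpen_Iio⟩

section Coordinates

variable {X : Type u} [TopologicalSpace X] {ι : Type*} {ν : ι → Ordinal.{v}}
  (Φ : X ≃ₜ ∀ i, Set.Iio (ν i))

/-- The coordinates, as ordinals, of a point in a space identified with a product of ordinals. -/
def coord (x : X) (i : ι) : Ordinal.{v} := (Φ x i).1

theorem continuous_coord (i : ι) : Continuous fun x => coord Φ x i :=
  continuous_subtype_val.comp ((continuous_apply i).comp Φ.continuous)

theorem isClopen_setOf_coord_le (c : Ordinal.{v}) (i : ι) : IsClopen {x | coord Φ x i ≤ c} :=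
  (isClopen_Iic_ordinal c).preimage (continuous_coord Φ i)

theorem coord_lt (x : X) (i : ι) : coord Φ x i < ν i := (Φ x i).2

theorem setOf_sameCuts_mem_nhds [Finite ι] (F : Finset Ordinal.{v}) (y : X) :
    {z | SameCuts F (coord Φ y) (coord Φ z)} ∈ 𝓝 y := by
  have : ∀ c i, {z | coord Φ y i ≤ c ↔ coord Φ z i ≤ c} ∈ 𝓝 y := fun c i => by
    by_cases h : coord Φ y i ≤ c
    · filter_upwards [(isClopen_setOf_coord_le Φ c i).isOpen.mem_nhds h] with z hz
      exact iff_of_true h hz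
    · filter_upwards [(isClopen_setOf_coord_le Φ c i).compl.isOpen.mem_nhds h] with z hz
      exact iff_of_false h hz
  refine mem_of_superset ((Filter.biInter_finset_mem F).2 fun c _ =>
    Filter.iInter_mem.2 fun i => this c i) fun z hz c hc i => ?_
  exact Set.mem_iInter.1 (Set.mem_iInter₂.1 hz c hc) i

theorem exists_finset_sameCuts_of_mem_nhds [Finite ι] {U : Set X} {y : X} (hU : U ∈ 𝓝 y) :
    ∃ F : Finset Ordinal.{v}, ∀ z, SameCuts F (coord Φ y) (coord Φ z) → z ∈ U := by
  classical
  cases nonempty_fintype ι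
  rw [Φ.isInducing.nhds_eq_comap, mem_comap] at hU
  obtain ⟨W, hW, hWU⟩ := hU
  rw [nhds_pi, Filter.mem_pi'] at hW
  obtain ⟨I, t, ht, htW⟩ := hW
  choose F hF using fun i => exists_finset_cuts_of_mem_nhds (Φ y i) (ht i)
  refine ⟨Finset.univ.biUnion F, fun z hz => hWU (htW fun i _ => hF i _ fun c hc => ?_)⟩
  exact hz c (Finset.mem_biUnion.2 ⟨i, Finset.mem_univ i, hc⟩) i

theorem exists_finset_sameCuts_of_isCompact [Finite ι] {L U : Set X} (hL : IsCompact L)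
    (hU : IsOpen U) (hLU : L ⊆ U) :
    ∃ F : Finset Ordinal.{v}, ∀ y ∈ L, ∀ z, SameCuts F (coord Φ y) (coord Φ z) → z ∈ U := by
  classical
  refine hL.induction_on (p := fun S => ∃ F : Finset Ordinal.{v}, ∀ y ∈ S, ∀ z,
    SameCuts F (coord Φ y) (coord Φ z) → z ∈ U) ⟨∅, by simp⟩ ?_ ?_ ?_
  · rintro S T hST ⟨F, hF⟩
    exact ⟨F, fun y hy => hF y (hST hy)⟩
  · rintro S T ⟨F, hF⟩ ⟨G, hG⟩
    refine ⟨F ∪ G, fun y hy z hz => ?_⟩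
    rcases hy with hy | hy
    · exact hF y hy z fun c hc => hz c (Finset.mem_union_left _ hc)
    · exact hG y hy z fun c hc => hz c (Finset.mem_union_right _ hc)
  · intro y hy
    obtain ⟨F, hF⟩ := exists_finset_sameCuts_of_mem_nhds Φ (hU.mem_nhds (hLU hy))
    refine ⟨_, mem_nhdsWithin_of_mem_nhds (setOf_sameCuts_mem_nhds Φ F y), F, fun y' hy' z hz => ?_⟩
    exact hF z fun c hc i => (hy' c hc i).trans (hz c hc i)

theorem exists_finset_sameCuts_of_mem_nhds_compactOpen [Finite ι] {f : C(X, X)} {W : Set C(X, X)}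
    (hW : W ∈ 𝓝 f) : ∃ F : Finset Ordinal.{v}, ∀ g : C(X, X),
      (∀ x, SameCuts F (coord Φ (f x)) (coord Φ (g x))) → g ∈ W := by
  classical
  let S : Finset Ordinal.{v} → Set C(X, X) := fun F =>
    {g | ∀ x, SameCuts F (coord Φ (f x)) (coord Φ (g x))}
  have hdir : Directed (· ≥ ·) fun F => 𝓟 (S F) := fun F G =>
    ⟨F ∪ G, principal_mono.2 fun g hg x c hc => hg x c (Finset.mem_union_left _ hc),
      principal_mono.2 fun g hg x c hc => hg x c (Finset.mem_union_right _ hc)⟩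
  have hle : ⨅ F, 𝓟 (S F) ≤ 𝓝 f := by
    rw [ContinuousMap.nhds_compactOpen]
    refine le_iInf₂ fun K hK => le_iInf₂ fun U hU => le_iInf fun hKU => ?_
    obtain ⟨F, hF⟩ := exists_finset_sameCuts_of_isCompact Φ (hK.image f.continuous) hU
      (Set.mapsTo_iff_image_subset.1 hKU)
    refine iInf_le_of_le F (principal_mono.2 fun g hg x hx => ?_)
    exact hF _ (Set.mem_image_of_mem f hx) _ (hg x)
  obtain ⟨F, hF⟩ := (mem_iInf_of_directed hdir W).1 (hle hW)
  exact ⟨F, fun g hg => hF hg⟩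

theorem setOf_sameCuts_mem_nhds_betaTopology [Finite ι] (F : Finset Ordinal.{v})
    (h₀ : homeoCpt X) :
    {h : homeoCpt X | ∀ x, SameCuts F (coord Φ (h₀.1 x)) (coord Φ (h.1 x))} ∈
      @nhds _ (betaTopology X) h₀ := by
  let _ := betaTopology X
  refine mem_of_superset ((Filter.biInter_finset_mem F).2 fun c _ => Filter.iInter_mem.2 fun i =>
    setOf_mem_iff_mem_nhds_betaTopology (isClopen_setOf_coord_le Φ c i) h₀)
    fun h hh x c hc i => ?_
  exact Set.mem_iInter.1 (Set.mem_iInter₂.1 hh c hc) i x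

theorem isCompact_setOf_coord_le {α : Ordinal.{v}}
    (hα : ∀ i, α < ν i ∨ ν i ∈ Set.range Order.succ) : IsCompact {x | ∀ i, coord Φ x i ≤ α} := by
  have h : ∀ i, IsCompact {t : Set.Iio (ν i) | t.1 ≤ α} := fun i => by
    rw [IsEmbedding.subtypeVal.isCompact_iff]
    have himg : Subtype.val '' {t : Set.Iio (ν i) | t.1 ≤ α} = Set.Iio (ν i) ∩ Set.Iic α := by
      ext s
      simp [and_comm]
    rw [himg]
    rcases hα i with h | ⟨m, hm⟩
    · rw [Set.inter_eq_right.2 (Set.Iic_subset_Iio.2 h)]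
      exact isCompact_iff_compactSpace.2 inferInstance
    · rw [← hm, Order.Iio_succ, Set.Iic_inter_Iic]
      exact isCompact_iff_compactSpace.2 inferInstance
  have : {x | ∀ i, coord Φ x i ≤ α} =
      Φ ⁻¹' Set.univ.pi fun i => {t : Set.Iio (ν i) | t.1 ≤ α} := by
    ext x
    simp [coord]
  rw [this]
  exact Φ.isCompact_preimage.2 (isCompact_univ_pi h)

theorem exists_coord_le_of_isCompact {K : Set X} (hK : IsCompact K) {i : ι} (hi : 0 < ν i) :
    ∃ α < ν i, ∀ x ∈ K, coord Φ x i ≤ α := by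
  rcases K.eq_empty_or_nonempty with rfl | hne
  · exact ⟨0, hi, by simp⟩
  · obtain ⟨x, _, hx⟩ := hK.exists_isMaxOn hne (continuous_coord Φ i).continuousOn
    exact ⟨_, coord_lt Φ x i, fun y hy => hx hy⟩

theorem exists_mem_homeoOn_of_mem_homeoCpt [Finite ι] {o : Ordinal.{v}} (ho : 0 < o)
    (hν : ∀ i, ν i ≤ o) (h : homeoCpt X) :
    ∃ α < o, h.1 ∈ homeoOn {x | ∀ i, coord Φ x i ≤ α} := by
  obtain ⟨K, hK⟩ := Set.mem_iUnion.1 h.2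
  have : ∀ i, ∃ α : Set.Iio o, ∀ x ∈ (K : Set X), coord Φ x i ≤ α.1 := fun i => by
    rcases (K : Set X).eq_empty_or_nonempty with he | ⟨x, _⟩
    · exact ⟨⟨0, ho⟩, fun x hx => absurd hx (he ▸ Set.notMem_empty x)⟩
    · obtain ⟨α, hα, hαK⟩ := exists_coord_le_of_isCompact Φ K.isCompact
        (zero_le.trans_lt (coord_lt Φ x i))
      exact ⟨⟨α, hα.trans_le (hν i)⟩, hαK⟩
  choose α hα using this
  have : Nonempty (Set.Iio o) := ⟨⟨0, ho⟩⟩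
  obtain ⟨M, hM⟩ := Finite.exists_le α
  exact ⟨M.1, M.2, homeoOn_mono (fun x hx i => (hα i x hx).trans (hM i)) hK⟩

end Coordinates

section ClosurePoint

open Cardinal Ordinal

theorem mk_finset_lt {κ : Cardinal.{u}} (hκ : ℵ₀ < κ) {α : Type u} (h : #α < κ) :
    #(Finset α) < κ := by
  cases finite_or_infinite α
  · exact (lt_aleph0_of_finite _).trans hκ
  · rwa [mk_finset_of_infinite]

/-- Closing off: a bound for `s` on finite subsets of `δ` stays below `κ` by regularity. Iterating
it `ω` times stays below `κ` too, and a finite subset of the limit already lies below some stage. -/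
theorem exists_closure_point {κ : Cardinal.{u}} (hκ : ℵ₀ < κ) (hreg : κ.IsRegular)
    (s : Finset Ordinal.{u} → Ordinal.{u}) (hs : ∀ F, s F < κ.ord) {β : Ordinal.{u}}
    (hβ : β < κ.ord) :
    ∃ α < κ.ord, β < α ∧ ∀ F : Finset Ordinal.{u}, (∀ c ∈ F, c < α) → s F < α := by
  classical
  let G : Ordinal.{u} → Ordinal.{u} := fun δ =>
    ⨆ F : Finset δ.ToType, s (F.image fun t => (ToType.mk.symm t).1)
  have hG : ∀ δ (F : Finset Ordinal.{u}), (∀ c ∈ F, c < δ) → s F ≤ G δ := fun δ F hF => by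
    let F' : Finset δ.ToType := F.attach.image fun c => ToType.mk ⟨c.1, hF c.1 c.2⟩
    have : F = F'.image fun t => (ToType.mk.symm t).1 := by
      ext c
      simp only [F', Finset.mem_image, Finset.mem_attach, true_and, Subtype.exists]
      constructor
      · intro hc
        exact ⟨_, ⟨c, hc, rfl⟩, by simp⟩
      · rintro ⟨_, ⟨d, hd, rfl⟩, rfl⟩
        simpa using hd
    conv_lhs => rw [this]
    exact Ordinal.le_iSup (fun F : Finset δ.ToType => s (F.image fun t => (ToType.mk.symm t).1)) F'
  have hGκ : ∀ δ < κ.ord, G δ < κ.ord := fun δ hδ => by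
    refine iSup_lt_of_lt_cof ?_ fun _ => hs _
    rw [hreg.cof_ord]
    exact mk_finset_lt hκ (by rwa [mk_toType, ← lt_ord])
  let f : Ordinal.{u} → Ordinal.{u} := fun δ => max (δ + 1) (G δ + 1)
  have hlim := isSuccLimit_ord hκ.le
  have hf : ∀ δ < κ.ord, f δ < κ.ord := fun δ hδ =>
    max_lt (hlim.add_one_lt hδ) (hlim.add_one_lt (hGκ δ hδ))
  have hmono : Monotone fun n => f^[n] β := monotone_nat_of_le_succ fun n => by
    rw [Function.iterate_succ_apply']
    exact le_self_add.trans (le_max_left _ _)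
  refine ⟨nfp f β, nfp_lt_ord (by rwa [hreg.cof_ord]) hf hβ, ?_, fun F hF => ?_⟩
  · exact lt_nfp_iff.2 ⟨1, (lt_add_one β).trans_le (le_max_left _ _)⟩
  · choose n hn using fun c : F => lt_nfp_iff.1 (hF c.1 c.2)
    obtain ⟨N, hN⟩ := Finite.exists_le n
    refine lt_nfp_iff.2 ⟨N + 1, ?_⟩
    rw [Function.iterate_succ_apply']
    refine ((hG _ F fun c hc => ?_).trans_lt (lt_add_one _)).trans_le (le_max_right _ _)
    exact (hn ⟨c, hc⟩).trans_le (hmono (hN _))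

end ClosurePoint

open Cardinal in
theorem hasCSHP_of_homeomorph_pi {X : Type u} [TopologicalSpace X] [T35Space X] {ι : Type*}
    [Finite ι] {ν : ι → Ordinal.{u}} (Φ : X ≃ₜ ∀ i, Set.Iio (ν i)) {κ : Cardinal.{u}}
    (hκ : ℵ₀ < κ) (hreg : κ.IsRegular) (hν : ∀ i, ν i ≤ κ.ord)
    (hν' : ∀ i, ν i = κ.ord ∨ ν i ∈ Set.range Order.succ) : HasCSHP X := by
  classical
  refine le_antisymm colimTopology_le_betaTopology ?_
  intro O hO
  rw [isOpen_colimTopology_iff] at hO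
  let _ := betaTopology X
  refine isOpen_iff_mem_nhds.2 fun h₀ h₀O => ?_
  by_contra hnot
  have hex : ∀ F : Finset Ordinal.{u}, ∃ h : homeoCpt X,
      (∀ x, SameCuts F (coord Φ (h₀.1 x)) (coord Φ (h.1 x))) ∧ h ∉ O := fun F => by
    by_contra! hF
    exact hnot (mem_of_superset (setOf_sameCuts_mem_nhds_betaTopology Φ F h₀) hF)
  choose h hcut hnO using hex
  choose s hs hsupp using exists_mem_homeoOn_of_mem_homeoCpt (X := X) Φ hreg.ord_pos hν
  obtain ⟨α, hα, h₀α, hclosed⟩ := exists_closure_point hκ hreg (fun F => s (h F)) (fun F => hs _)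
    (hs h₀)
  let K : Compacts X := ⟨{x | ∀ i, coord Φ x i ≤ α}, isCompact_setOf_coord_le Φ fun i =>
    (hν' i).imp (fun e => by rwa [e]) id⟩
  have hmem : ∀ g : homeoCpt X, s g < α → g.1 ∈ homeoOn (K : Set X) := fun g hg =>
    homeoOn_mono (fun x hx i => (hx i).trans hg.le) (hsupp g)
  have hO' := hO K
  rw [homeoOnTopology, homeoTopology, induced_compose, isOpen_induced_iff] at hO'
  obtain ⟨W, hW, hWO⟩ := hO'
  have hW₀ : (h₀.1 : C(X, X)) ∈ W := by
    have : (⟨h₀.1, hmem h₀ h₀α⟩ : homeoOn (K : Set X)) ∈ inclCpt K ⁻¹' O := h₀O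
    rwa [← hWO] at this
  obtain ⟨E, hE⟩ := exists_finset_sameCuts_of_mem_nhds_compactOpen Φ (hW.mem_nhds hW₀)
  -- Only cuts below `α` are covered by the closure property.
  let F := E.filter (· < α)
  have hFα : s (h F) < α := hclosed F fun c hc => (Finset.mem_filter.1 hc).2
  refine hnO F ?_
  have hin : (⟨(h F).1, hmem _ hFα⟩ : homeoOn (K : Set X)) ∈ inclCpt K ⁻¹' O := by
    rw [← hWO]
    refine hE _ fun x c hc i => ?_
    by_cases hcα : c < α
    · exact hcut F x c (Finset.mem_filter.2 ⟨hc, hcα⟩) i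
    by_cases hx : x ∈ (K : Set X)
    -- A homeomorphism supported in `K` maps `K` to itself: otherwise its inverse would fix a point
    -- off `K` that it sends into `K`.
    · have hpres : ∀ g : homeoCpt X, s g < α → coord Φ (g.1 x) i ≤ c := fun g hg => by
        refine le_trans ?_ (not_lt.1 hcα)
        by_contra hgx
        have hgx' : g.1 x ∉ (K : Set X) := fun h => hgx (h i)
        have := (homeoOn (K : Set X)).inv_mem (hmem g hg) (g.1 x) hgx'
        rw [show (g.1⁻¹ : X ≃ₜ X) (g.1 x) = x from g.1.symm_apply_apply x] at this
        exact hgx' (this ▸ hx)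
      exact iff_of_true (hpres h₀ h₀α) (hpres (h F) hFα)
    · change coord Φ (h₀.1 x) i ≤ c ↔ coord Φ ((h F).1 x) i ≤ c
      rw [hmem h₀ h₀α x hx, hmem _ hFα x hx]
  exact hin

end CSHP

/-! ### Necessity, and the theorem. -/

namespace CSHP

open TopologicalSpace Topology Filter Cardinal Ordinal

section Axis

variable {X : Type u} [TopologicalSpace X] {ι : Type*} {ν : ι → Ordinal.{v}}

open Classical in
/-- The points all of whose coordinates except the `i`-th vanish. -/
noncomputable def axis (Φ : X ≃ₜ ∀ i, Set.Iio (ν i)) (hν : ∀ i, 0 < ν i) (i : ι)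
    (t : Set.Iio (ν i)) : X :=
  Φ.symm (Function.update (fun j => ⟨0, hν j⟩) i t)

theorem apply_axis_self (Φ : X ≃ₜ ∀ i, Set.Iio (ν i)) (hν : ∀ i, 0 < ν i)
    (i : ι) (t : Set.Iio (ν i)) : Φ (axis Φ hν i t) i = t := by
  simp [axis]

theorem coord_axis_self (Φ : X ≃ₜ ∀ i, Set.Iio (ν i)) (hν : ∀ i, 0 < ν i)
    (i : ι) (t : Set.Iio (ν i)) : coord Φ (axis Φ hν i t) i = t := by
  rw [coord, apply_axis_self]

theorem coord_axis_of_ne (Φ : X ≃ₜ ∀ i, Set.Iio (ν i)) (hν : ∀ i, 0 < ν i)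
    {i j : ι} (t : Set.Iio (ν i)) (h : j ≠ i) :
    coord Φ (axis Φ hν i t) j = 0 := by
  simp [axis, coord, h]

theorem isOpenEmbedding_axis [Finite ι]
    (Φ : X ≃ₜ ∀ i, Set.Iio (ν i)) (hν : ∀ i, 0 < ν i) (i : ι) : IsOpenEmbedding (axis Φ hν i) := by
  have hc : Continuous (axis Φ hν i) := by
    classical
    unfold axis
    refine Φ.symm.continuous.comp ?_
    have h0 : Continuous fun _ : Set.Iio (ν i) => fun j => (⟨0, hν j⟩ : Set.Iio (ν j)) :=
      continuous_const
    exact h0.update i continuous_id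
  have hinv : Function.LeftInverse (fun x => Φ x i) (axis Φ hν i) := apply_axis_self Φ hν i
  refine ⟨hinv.isEmbedding ((continuous_apply i).comp Φ.continuous) hc, ?_⟩
  -- The axis is open because `0` is isolated in each of the finitely many other factors.
  have : Set.range (axis Φ hν i) = ⋂ j : {j // j ≠ i}, {x | coord Φ x j ≤ 0} := by
    ext x
    simp only [Set.mem_iInter, Set.mem_ofPred_eq]
    constructor
    · rintro ⟨t, rfl⟩ j
      exact (coord_axis_of_ne Φ hν t j.2).le
    · intro h
      refine ⟨Φ x i, Φ.injective (funext fun j => ?_)⟩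
      by_cases hj : j = i
      · subst hj
        exact apply_axis_self Φ hν _ _
      · refine Subtype.ext ?_
        change coord Φ _ j = coord Φ x j
        rw [coord_axis_of_ne Φ hν _ hj]
        exact (le_antisymm (h ⟨j, hj⟩) zero_le).symm
  rw [this]
  exact isOpen_iInter_of_finite fun j => (isClopen_setOf_coord_le Φ 0 j.1).isOpen

/-- Along a limit coordinate there are isolated points, indexed by its cofinality, which
eventually leave every compact set. -/
theorem exists_escaping_points [Finite ι]
    (Φ : X ≃ₜ ∀ i, Set.Iio (ν i)) (hν : ∀ i, 0 < ν i) {i : ι} (hlim : Order.IsSuccLimit (ν i))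
    {b : Ordinal.{v}} (hb : b < ν i) :
    ∃ x : Set.Iio (ν i).cof.ord → X, Function.Injective x ∧ (∀ γ, IsOpen ({x γ} : Set X)) ∧
      (∀ γ, b < coord Φ (x γ) i) ∧
      ∀ K : Set X, IsCompact K → ∃ δ < (ν i).cof.ord, ∀ γ, x γ ∈ K → γ.1 < δ := by
  obtain ⟨f, hf⟩ := exists_isFundamentalSeq (o := ν i) rfl
  have hcof : ℵ₀ ≤ (ν i).cof := aleph0_le_cof_iff.2 (one_lt_cof_iff.2 hlim)
  have hub : ∀ t < ν i, ∃ γ, t ≤ (f γ).1 := fun t ht => by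
    obtain ⟨_, ⟨γ, rfl⟩, h⟩ := hf.isCofinal_range ⟨t, ht⟩
    exact ⟨γ, h⟩
  obtain ⟨γ₀, hγ₀⟩ := hub b hb
  have hadd : ∀ γ : Set.Iio (ν i).cof.ord, γ₀.1 + γ.1 < (ν i).cof.ord := fun γ =>
    isPrincipal_add_ord hcof γ₀.2 γ.2
  -- Shifting by `γ₀` puts every term at or above `b`; the successor taken in `y` makes the points
  -- isolated and the bound strict.
  let e : Set.Iio (ν i).cof.ord → Set.Iio (ν i).cof.ord := fun γ => ⟨γ₀.1 + γ.1, hadd γ⟩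
  have he : StrictMono e := fun γ γ' h => Subtype.mk_lt_mk.2 ((add_lt_add_iff_left _).2 h)
  let y : Set.Iio (ν i).cof.ord → Set.Iio (ν i) := fun γ =>
    ⟨(f (e γ)).1 + 1, hlim.add_one_lt (f (e γ)).2⟩
  have hy : StrictMono y := fun γ γ' h =>
    Subtype.mk_lt_mk.2 (Order.succ_strictMono (hf.strictMono (he h)))
  have haxis := isOpenEmbedding_axis Φ hν i
  refine ⟨fun γ => axis Φ hν i (y γ), haxis.injective.comp hy.injective, fun γ => ?_, fun γ => ?_,
    fun K hK => ?_⟩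
  · rw [← Set.image_singleton]
    exact haxis.isOpenMap _ (isOpen_singleton_subtype (isOpen_singleton_add_one _))
  · rw [coord_axis_self]
    have : f γ₀ ≤ f (e γ) := hf.strictMono.monotone (Subtype.mk_le_mk.2 le_self_add)
    exact (hγ₀.trans this).trans_lt (lt_add_one _)
  · obtain ⟨α, hα, hαK⟩ := exists_coord_le_of_isCompact Φ hK (hν i)
    obtain ⟨γ₁, hγ₁⟩ := hub α hα
    refine ⟨γ₁.1, γ₁.2, fun γ hγ => ?_⟩
    have h1 := hαK _ hγ
    rw [coord_axis_self] at h1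
    have h2 : f (e γ) < f γ₁ := Subtype.coe_lt_coe.1 ((lt_add_one _).trans_le (h1.trans hγ₁))
    exact (le_add_self (a := γ.1) (b := γ₀.1)).trans_lt (hf.strictMono.lt_iff_lt.1 h2)

theorem not_hasCSHP_of_cof_eq_aleph0 [T35Space X] [Finite ι]
    (Φ : X ≃ₜ ∀ i, Set.Iio (ν i)) (hν : ∀ i, 0 < ν i) {i : ι}
    (hlim : Order.IsSuccLimit (ν i)) (hcof : (ν i).cof = ℵ₀) : ¬ HasCSHP X := by
  obtain ⟨x, hx, hiso, -, hK⟩ := exists_escaping_points Φ hν hlim (hν i)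
  have hord : (ν i).cof.ord = ω := by rw [hcof, ord_aleph0]
  refine not_hasCSHP_of_escaping_sequence
    (fun n : ℕ => x ⟨n, by rw [Set.mem_Iio, hord]; exact natCast_lt_omega0 n⟩)
    (fun m n h => by simpa using congrArg Subtype.val (hx h)) (fun n => hiso _) fun K hKc => ?_
  obtain ⟨δ, hδ, hδK⟩ := hK K hKc
  rw [hord, lt_omega0] at hδ
  obtain ⟨m, rfl⟩ := hδ
  exact (Set.finite_Iio m).subset fun n hn => by simpa using hδK _ hn

theorem not_hasCSHP_of_cof_lt [T35Space X] [Finite ι]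
    (Φ : X ≃ₜ ∀ i, Set.Iio (ν i)) (hν : ∀ i, 0 < ν i) {i j : ι}
    (hlim : Order.IsSuccLimit (ν i)) (hcof : ℵ₀ < (ν i).cof) (hj : (ν i).cof.ord < ν j) :
    ¬ HasCSHP X := by
  let φ : Set.Iic (ν i).cof.ord → X := fun t => axis Φ hν j ⟨t.1, lt_of_le_of_lt t.2 hj⟩
  have hφ : IsOpenEmbedding φ := by
    refine (isOpenEmbedding_axis Φ hν j).comp (g := axis Φ hν j)
      (f := Set.inclusion (Set.Iic_subset_Iio.2 hj)) ⟨IsEmbedding.inclusion _, ?_⟩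
    rw [Set.range_inclusion]
    exact (isClopen_Iic_ordinal _).isOpen.preimage continuous_subtype_val
  -- The copy of `[0, κ]` may lie on the same axis as the escaping points; starting them beyond `b`
  -- keeps the two apart.
  have hb : ∃ b < ν i, ∀ t, coord Φ (φ t) i ≤ b := by
    by_cases hij : i = j
    · subst hij
      exact ⟨_, hj, fun t => (coord_axis_self Φ hν _ _).trans_le t.2⟩
    · exact ⟨0, hν i, fun t => (coord_axis_of_ne Φ hν _ hij).le⟩
  obtain ⟨b, hb, hφb⟩ := hb
  obtain ⟨x, hx, hiso, hxb, hK⟩ := exists_escaping_points Φ hν hlim hb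
  refine not_hasCSHP_of_isOpenEmbedding_Iic hcof φ hφ x hx hiso ?_ hK
  rintro γ ⟨t, ht⟩
  exact (hxb γ).not_ge (ht ▸ hφb t)

end Axis

/-- A product of two finite families of ordinals as a product of initial segments. -/
noncomputable def prodHomeomorph {k l : ℕ} (lam : Fin k → Ordinal.{u}) (mu : Fin l → Ordinal.{u}) :
    ((∀ i, (lam i).ToType) × (∀ j, (mu j).ToType)) ≃ₜ
      ∀ s : Fin k ⊕ Fin l, Set.Iio (Sum.elim lam mu s) :=
  (Homeomorph.sumPiEquivProdPi (Fin k) (Fin l) fun s => (Sum.elim lam mu s).ToType).symm.trans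
    (Homeomorph.piCongrRight fun _ => ToType.mk.symm.toHomeomorph)

end CSHP

theorem theoremA {k l : ℕ} (lam : Fin k → Ordinal.{u}) (mu : Fin l → Ordinal.{u})
    (hlam : ∀ i, Order.IsSuccLimit (lam i))
    (hmu : ∀ j, mu j ∈ Set.range (Order.succ : Ordinal.{u} → Ordinal.{u})) :
    CSHP.HasCSHP ((∀ i, (lam i).ToType) × (∀ j, (mu j).ToType)) ↔
      ∃ κ : Cardinal.{u}, Cardinal.aleph0 < κ ∧ κ.IsRegular ∧
        (∀ i, lam i = κ.ord) ∧ (∀ j, mu j ≤ κ.ord) := by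
  have hpos : ∀ s, 0 < Sum.elim lam mu s := by
    rintro (i | j)
    · exact (hlam i).bot_lt
    · obtain ⟨m, hm⟩ := hmu j
      exact (Order.bot_lt_succ m).trans_eq hm
  constructor
  · intro H
    rcases isEmpty_or_nonempty (Fin k) with hk | hk
    -- Without limit factors any sufficiently large successor cardinal serves.
    · obtain ⟨M, hM⟩ := Finite.exists_le fun j => (mu j).card
      refine ⟨Order.succ (max Cardinal.aleph0 M), ?_, ?_, fun i => isEmptyElim i, fun j => ?_⟩
      · exact Order.lt_succ_of_le (le_max_left _ _)
      · exact Cardinal.isRegular_succ (le_max_left _ _)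
      · exact (Cardinal.lt_ord.2 (Order.lt_succ_of_le ((hM j).trans (le_max_right _ _)))).le
    · obtain ⟨i, hi⟩ := Finite.exists_min fun i => (lam i).cof
      have hcof : Cardinal.aleph0 < (lam i).cof :=
        (Ordinal.aleph0_le_cof_iff.2 (Ordinal.one_lt_cof_iff.2 (hlam i))).lt_of_ne fun h =>
          CSHP.not_hasCSHP_of_cof_eq_aleph0 (CSHP.prodHomeomorph lam mu) hpos (i := Sum.inl i)
            (hlam i) h.symm H
      have hle : ∀ s, Sum.elim lam mu s ≤ (lam i).cof.ord := fun s => not_lt.1 fun h =>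
        CSHP.not_hasCSHP_of_cof_lt (CSHP.prodHomeomorph lam mu) hpos (i := Sum.inl i) (j := s)
          (hlam i) hcof h H
      refine ⟨(lam i).cof, hcof, Cardinal.isRegular_cof (hlam i), fun i' => ?_,
        fun j => hle (Sum.inr j)⟩
      -- Minimality of the chosen cofinality gives the lower bound, as an ordinal is at least its
      -- cofinality.
      refine (hle (Sum.inl i')).antisymm ?_
      exact (Cardinal.ord_le_ord.2 (hi i')).trans (Ordinal.ord_cof_le _)
  · rintro ⟨κ, hκ, hreg, hl, hm⟩
    refine CSHP.hasCSHP_of_homeomorph_pi (CSHP.prodHomeomorph lam mu) hκ hreg ?_ ?_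
    · rintro (i | j)
      · exact (hl i).le
      · exact hm j
    · rintro (i | j)
      · exact .inl (hl i)
      · exact .inr (hmu j)
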